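/- For integers $p,q\ge 0$, a signed $(p,q)$-involution is a permutation $\pi$ of $\{1,\dots,p+q\}$ with $\pi^2=\mathrm{id}$ together with an assignment of a sign $+$ or $-$ to each fixed point of $\pi$ such that the number of $+$ signs minus the number of $-$ signs equals $p-q$. Let $\alpha_{p,q}$ be the number of signed $(p,q)$-involutions, and put $$x(r,s)=\frac{r}{rs+1},\qquad y(r,s)=\frac{rs^2-2rs+2s}{2(rs+1)}.$$ Then there are open neighbourhoods $U$ and $V$ of the origin in $\mathbb{C}^2$, with $rs+1\neq 0$ and $r\neq 1$ for all $(r,s)\in U$, such that $(r,s)\mapsto (x(r,s),y(r,s))$ is a homeomorphism from $U$ onto $V$ that fixes the origin and has analytic inverse; the series $$v(x,y)=\sum_{p,q\ge 0}\alpha_{p,q}\,x^q\,\frac{y^p}{p!}$$ converges absolutely for all $(x,y)\in V$; and for all $(r,s)\in U$, $$v\bigl(x(r,s),y(r,s)\bigr)=\frac{e^{s}(rs+1)}{1-r}.$$ -/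

import Mathlib

/-- The signed `(p,q)`-involutions: pairs consisting of a permutation `π` of an `n`-element set,
`n = p + q`, with `π ^ 2 = 1`, and an assignment `ε` of a sign `+` or `-` (that is, `1` or `-1`)
to each fixed point of `π`, such that the number of `+` signs minus the number of `-` signs
is the integer `p - q`. -/
def signedInvolutions (p q : ℕ) :
    Set ((π : Equiv.Perm (Fin (p + q))) × ({i : Fin (p + q) // π i = i} → ℤˣ)) :=
  {σ | σ.1 ^ 2 = 1 ∧
    ((Finset.univ.filter fun i => σ.2 i = 1).card : ℤ)
      - ((Finset.univ.filter fun i => σ.2 i = -1).card : ℤ) = (p : ℤ) - (q : ℤ)}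

/-- `α_{p,q}`, the number of signed `(p,q)`-involutions. -/
noncomputable def alpha (p q : ℕ) : ℕ := (signedInvolutions p q).ncard

/-- The `(p,q)`-th term `α_{p,q} x^q y^p / p!` of the generating series, at `m = (p,q)`. -/
noncomputable def seriesTerm (x y : ℂ) (m : ℕ × ℕ) : ℂ :=
  (alpha m.1 m.2 : ℂ) * x ^ m.2 * (y ^ m.1 / (Nat.factorial m.1 : ℂ))

/-- The function `v(x,y)` represented by the series (meaningful where the series is summable). -/
noncomputable def v (x y : ℂ) : ℂ := ∑' m : ℕ × ℕ, seriesTerm x y m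

/-- The coordinate `x(r,s)`. -/
noncomputable def xCoord (r s : ℂ) : ℂ := r / (r * s + 1)

/-- The coordinate `y(r,s)`. -/
noncomputable def yCoord (r s : ℂ) : ℂ := (r * s ^ 2 - 2 * r * s + 2 * s) / (2 * (r * s + 1))

/-! Sort signed involutions by `a` plus signs, `b` minus signs and `k` two-cycles, so that `p = a +
k` and `q = b + k`; the series becomes a triple sum (`involution_count_eq`,
`hasSum_seriesTerm_of_tripleTerm`). Summing over `b` gives a negative power of `1 - x`. With `z = xy
/ (2(1-x)^2)` and `c = 1 + z c^2`, the sum over `k` is `c^a / (1 - 2zc)` (`chooseSeries_eq`), and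
the sum over `a` is then exponential: `v = exp(yc/(1-x)) / ((1-x)(1-2zc))`. The coordinates `r, s`
make `c` rational, with `yc/(1-x) = s` and `(1-x)(1-2zc) = (1-r)/(rs+1)`. The neighbourhoods come
from the inverse function theorem, the Jacobian at the origin being the identity. -/

/-! ### Counting signed involutions by two-cycles -/

/-- The number of sign functions on a finite type with a prescribed number of `+` signs. -/
lemma card_signs_filter_eq {F : Type*} [Fintype F] [DecidableEq F] (a : ℕ) :
    (Finset.univ.filter fun ε : F → ℤˣ => (Finset.univ.filter fun i => ε i = 1).card = a).card =
      (Fintype.card F).choose a := by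
  rw [← Finset.card_univ, ← Finset.card_powersetCard]
  refine Finset.card_bij' (fun ε _ => Finset.univ.filter fun i => ε i = 1)
    (fun s _ i => if i ∈ s then 1 else -1) ?_ ?_ ?_ ?_
  · intro ε hε
    simpa [Finset.mem_powersetCard] using hε
  · intro s hs
    rw [Finset.mem_powersetCard] at hs
    simp [hs.2]
  · intro ε _
    funext i
    rcases Int.units_eq_one_or (ε i) with h | h <;> simp [h]
  · intro s _
    ext i
    by_cases hi : i ∈ s <;> simp [hi]

lemma card_signs_add {F : Type*} [Fintype F] (ε : F → ℤˣ) :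
    (Finset.univ.filter fun i => ε i = 1).card + (Finset.univ.filter fun i => ε i = -1).card =
      Fintype.card F := by
  have h : (Finset.univ.filter fun i => ε i = -1) = Finset.univ.filter fun i => ¬ ε i = 1 := by
    ext i
    rcases Int.units_eq_one_or (ε i) with h | h <;> simp [h]
  rw [h, Finset.card_filter_add_card_filter_not, Finset.card_univ]

lemma perm_sq_eq_one_iff_cycleType {α : Type*} [Fintype α] [DecidableEq α] (π : Equiv.Perm α) :
    π ^ 2 = 1 ↔ π.cycleType = Multiset.replicate (Multiset.card π.cycleType) 2 := by
  have : Fact (Nat.Prime 2) := ⟨Nat.prime_two⟩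
  rw [Equiv.Perm.pow_prime_eq_one_iff, Multiset.eq_replicate_card]

lemma card_fixed_add_two_mul {n : ℕ} (π : Equiv.Perm (Fin n)) {k : ℕ}
    (h : π.cycleType = Multiset.replicate k 2) :
    Fintype.card {i : Fin n // π i = i} + 2 * k = n := by
  have h1 := Equiv.Perm.sum_cycleType π
  have h2 : Fintype.card {i : Fin n // π i = i} + π.support.card = n := by
    rw [Fintype.card_subtype]
    have : π.support = Finset.univ.filter fun i => ¬ π i = i := by
      ext i
      simp
    rw [this, Finset.card_filter_add_card_filter_not, Finset.card_univ, Fintype.card_fin]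
  rw [h, Multiset.sum_replicate, smul_eq_mul] at h1
  omega

/-- The number of involutions with exactly `k` two-cycles. -/
lemma card_cycleType_replicate_two_mul {n k : ℕ} (h : 2 * k ≤ n) :
    (Finset.univ.filter fun π : Equiv.Perm (Fin n) =>
      π.cycleType = Multiset.replicate k 2).card * ((n - 2 * k).factorial * 2 ^ k * k.factorial) =
      n.factorial := by
  have := Equiv.Perm.card_of_cycleType_mul_eq (Fin n) (Multiset.replicate k 2)
  rw [if_pos] at this
  · rcases Nat.eq_zero_or_pos k with rfl | hk
    · simpa using this
    · simpa [Multiset.toFinset_replicate, hk.ne', mul_comm k 2] using this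
  · constructor
    · simpa [mul_comm k 2] using h
    · intro a ha
      exact (Multiset.eq_of_mem_replicate ha).ge

lemma alpha_eq_sum (p q : ℕ) :
    alpha p q = ∑ k ∈ Finset.range (min p q + 1),
      (Finset.univ.filter fun π : Equiv.Perm (Fin (p + q)) =>
        π.cycleType = Multiset.replicate k 2).card * (p + q - 2 * k).choose (p - k) := by
  classical
  have hS : signedInvolutions p q = ((Finset.univ.filter fun σ => σ ∈ signedInvolutions p q :
      Finset ((π : Equiv.Perm (Fin (p + q))) × ({i : Fin (p + q) // π i = i} → ℤˣ))) :
      Set ((π : Equiv.Perm (Fin (p + q))) × ({i : Fin (p + q) // π i = i} → ℤˣ))) := by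
    ext σ
    simp
  rw [alpha, hS, Set.ncard_coe_finset]
  -- The signs number `p + q - 2k` in total and differ by `p - q`, which forces `p - k` plus and `q
  -- - k` minus signs.
  have key : ∀ (π : Equiv.Perm (Fin (p + q))) (ε : {i : Fin (p + q) // π i = i} → ℤˣ) (k : ℕ),
      π.cycleType = Multiset.replicate k 2 →
      ((⟨π, ε⟩ : (π : Equiv.Perm (Fin (p + q))) × ({i : Fin (p + q) // π i = i} → ℤˣ)) ∈
        signedInvolutions p q ↔ (Finset.univ.filter fun i => ε i = 1).card + k = p ∧
          (Finset.univ.filter fun i => ε i = -1).card + k = q) := by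
    intro π ε k hk
    have h1 := card_fixed_add_two_mul π hk
    have h2 := card_signs_add ε
    have h3 : π ^ 2 = 1 := by
      rw [perm_sq_eq_one_iff_cycleType, hk, Multiset.card_replicate]
    simp only [signedInvolutions, Set.mem_ofPred_eq, h3, true_and]
    omega
  rw [Finset.card_eq_sum_card_fiberwise (f := fun σ => Multiset.card σ.1.cycleType)
    (t := Finset.range (min p q + 1))]
  · refine Finset.sum_congr rfl fun k hk => ?_
    rw [Finset.mem_range] at hk
    rw [show (Finset.univ.filter fun σ => σ ∈ signedInvolutions p q).filter
        (fun σ => Multiset.card σ.1.cycleType = k) =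
        (Finset.univ.filter fun π : Equiv.Perm (Fin (p + q)) =>
        π.cycleType = Multiset.replicate k 2).sigma fun π => Finset.univ.filter
          fun ε : {i : Fin (p + q) // π i = i} → ℤˣ =>
            (Finset.univ.filter fun i => ε i = 1).card = p - k from ?_, Finset.card_sigma]
    · rw [← smul_eq_mul, ← Finset.sum_const]
      refine Finset.sum_congr rfl fun π hπ => ?_
      have h1 := card_fixed_add_two_mul π (Finset.mem_filter.1 hπ).2
      rw [card_signs_filter_eq]
      congr 1
      omega
    · ext ⟨π, ε⟩
      simp only [Finset.mem_filter, Finset.mem_univ, true_and, Finset.mem_sigma]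
      constructor
      · rintro ⟨h1, h2⟩
        have h3 := (perm_sq_eq_one_iff_cycleType π).1 h1.1
        rw [h2] at h3
        have := (key π ε k h3).1 h1
        exact ⟨h3, by omega⟩
      · rintro ⟨h1, h2⟩
        have h3 := card_fixed_add_two_mul π h1
        have h4 := card_signs_add ε
        refine ⟨(key π ε k h1).2 ⟨by omega, by omega⟩, ?_⟩
        rw [h1, Multiset.card_replicate]
  · rintro ⟨π, ε⟩ hσ
    have h1 : (⟨π, ε⟩ : (π : Equiv.Perm (Fin (p + q))) ×
        ({i : Fin (p + q) // π i = i} → ℤˣ)) ∈ signedInvolutions p q := by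
      simpa using hσ
    have := (key π ε _ ((perm_sq_eq_one_iff_cycleType π).1 h1.1)).1 h1
    simp only [Finset.coe_range, Set.mem_Iio]
    omega

/-! ### The coefficients of the triple series -/

/-- The contribution to the generating series of the signed involutions with `a` plus signs,
`b` minus signs and `k` two-cycles. -/
noncomputable def tripleTerm (x y : ℂ) (a k b : ℕ) : ℂ :=
  ((b + (a + 2 * k)).choose (a + 2 * k) : ℂ) * ((a + 2 * k).choose k : ℂ) *
    (x ^ (b + k) * y ^ (a + k)) / (2 ^ k * (a.factorial : ℂ))

/-- Both sides equal `(a+b+2k)! / (2^k k! a! b! (a+k)!)`. The right-hand form lets the sums over `b`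
and `k` be taken separately. -/
lemma involution_count_eq (a b k : ℕ) :
    (((Finset.univ.filter fun π : Equiv.Perm (Fin ((a + k) + (b + k))) =>
      π.cycleType = Multiset.replicate k 2).card * (a + b).choose a : ℕ) : ℂ) /
        ((a + k).factorial : ℂ) =
    ((b + (a + 2 * k)).choose (a + 2 * k) : ℂ) * ((a + 2 * k).choose k : ℂ) /
      (2 ^ k * (a.factorial : ℂ)) := by
  have h1 := card_cycleType_replicate_two_mul (n := (a + k) + (b + k)) (k := k) (by omega)
  rw [show (a + k) + (b + k) - 2 * k = a + b by omega] at h1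
  set N := (Finset.univ.filter fun π : Equiv.Perm (Fin ((a + k) + (b + k))) =>
      π.cycleType = Multiset.replicate k 2).card
  have h2 := Nat.add_choose_mul_factorial_mul_factorial b a
  have h3 := Nat.add_choose_mul_factorial_mul_factorial b (a + 2 * k)
  have h4 := Nat.add_choose_mul_factorial_mul_factorial (a + k) k
  rw [add_comm b a] at h2
  rw [show b + (a + 2 * k) = (a + k) + (b + k) by omega] at h3 ⊢
  rw [show a + k + k = a + 2 * k by omega] at h4
  have hf : ∀ n : ℕ, (n.factorial : ℂ) ≠ 0 := fun n => by exact_mod_cast n.factorial_ne_zero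
  have h1' := congrArg (Nat.cast : ℕ → ℂ) h1
  have h2' := congrArg (Nat.cast : ℕ → ℂ) h2
  have h3' := congrArg (Nat.cast : ℕ → ℂ) h3
  have h4' := congrArg (Nat.cast : ℕ → ℂ) h4
  push_cast at h1' h2' h3' h4' ⊢
  rw [div_eq_div_iff (hf _) (mul_ne_zero (pow_ne_zero _ two_ne_zero) (hf _))]
  apply mul_right_cancel₀ (mul_ne_zero (hf k) (hf b))
  rw [← h3', ← h4', ← h2'] at h1'
  linear_combination h1'

lemma seriesTerm_eq_sum (x y : ℂ) (p q : ℕ) :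
    seriesTerm x y (p, q) =
      ∑ k ∈ Finset.range (min p q + 1), tripleTerm x y (p - k) k (q - k) := by
  simp only [seriesTerm]
  rw [alpha_eq_sum, Nat.cast_sum, Finset.sum_mul, Finset.sum_mul]
  refine Finset.sum_congr rfl fun k hk => ?_
  rw [Finset.mem_range] at hk
  obtain ⟨a, rfl⟩ : ∃ a, p = a + k := ⟨p - k, by omega⟩
  obtain ⟨b, rfl⟩ : ∃ b, q = b + k := ⟨q - k, by omega⟩
  have h := involution_count_eq a b k
  simp only [Nat.add_sub_cancel, tripleTerm]
  rw [show (a + k) + (b + k) - 2 * k = a + b by omega]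
  linear_combination (x ^ (b + k) * y ^ (a + k)) * h

/-! ### Closed form of the binomial series in `k` -/

/-- The generating series `∑ (a + 2k choose k) z ^ k`. -/
noncomputable def chooseSeries (z : ℂ) (a : ℕ) : ℂ := ∑' k : ℕ, ((a + 2 * k).choose k : ℂ) * z ^ k

lemma norm_choose_mul_pow_le (z : ℂ) (a k : ℕ) :
    ‖((a + 2 * k).choose k : ℂ) * z ^ k‖ ≤ 2 ^ a * (4 * ‖z‖) ^ k := by
  rw [norm_mul, norm_pow, Complex.norm_natCast]
  have h : ((a + 2 * k).choose k : ℝ) ≤ 2 ^ a * 4 ^ k := by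
    have := Nat.choose_le_two_pow (a + 2 * k) k
    rw [pow_add, pow_mul] at this
    exact_mod_cast this
  calc _ ≤ (2 ^ a * 4 ^ k) * ‖z‖ ^ k := by gcongr
    _ = _ := by rw [mul_pow]; ring

lemma summable_chooseSeries {z : ℂ} (hz : 4 * ‖z‖ < 1) (a : ℕ) :
    Summable fun k : ℕ => ((a + 2 * k).choose k : ℂ) * z ^ k :=
  .of_norm_bounded ((summable_geometric_of_lt_one (by positivity) hz).mul_left _)
    (norm_choose_mul_pow_le z a)

lemma norm_chooseSeries_le {z : ℂ} (hz : 4 * ‖z‖ < 1) (a : ℕ) :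
    ‖chooseSeries z a‖ ≤ 2 ^ a * (1 - 4 * ‖z‖)⁻¹ :=
  tsum_of_norm_bounded ((hasSum_geometric_of_lt_one (by positivity) hz).mul_left _)
    (norm_choose_mul_pow_le z a)

/-- Pascal's rule, after splitting off the terms at `k = 0`. -/
lemma chooseSeries_succ {z : ℂ} (hz : 4 * ‖z‖ < 1) (a : ℕ) :
    chooseSeries z (a + 1) = chooseSeries z a + z * chooseSeries z (a + 2) := by
  unfold chooseSeries
  have h := ((summable_nat_add_iff 1).2 (summable_chooseSeries hz a)).tsum_add
    ((summable_chooseSeries hz (a + 2)).mul_left z)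
  rw [(summable_chooseSeries hz (a + 1)).tsum_eq_zero_add,
    (summable_chooseSeries hz a).tsum_eq_zero_add, ← tsum_mul_left, add_assoc (_ * _), ← h]
  congr 1
  · simp
  · refine tsum_congr fun k => ?_
    rw [show a + 1 + 2 * (k + 1) = (a + 2 + 2 * k) + 1 by ring, Nat.choose_succ_succ,
      show a + 2 * (k + 1) = a + 2 + 2 * k by ring]
    push_cast
    ring

/-- Central binomials are even: `C(2k+2, k+1) = 2 C(2k+1, k)`. -/
lemma chooseSeries_zero {z : ℂ} (hz : 4 * ‖z‖ < 1) :
    chooseSeries z 0 = 1 + 2 * z * chooseSeries z 1 := by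
  unfold chooseSeries
  rw [(summable_chooseSeries hz 0).tsum_eq_zero_add, ← tsum_mul_left]
  congr 1
  · simp
  · refine tsum_congr fun k => ?_
    have h := Nat.choose_symm_half k
    rw [show 0 + 2 * (k + 1) = (2 * k + 1) + 1 by ring, Nat.choose_succ_succ, Nat.succ_eq_add_one,
      h, show 1 + 2 * k = 2 * k + 1 by ring]
    push_cast
    ring

/-- The bounded-growth solution of the recurrence: `chooseSeries z a = c ^ a / (1 - 2 z c)` for the
root `c` of `c = 1 + z c ^ 2` with `‖2 z c‖ < 1`. -/
lemma chooseSeries_eq {z c : ℂ} (hz : 4 * ‖z‖ < 1) (hc : c = 1 + z * c ^ 2)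
    (hzc : ‖2 * (z * c)‖ < 1) (a : ℕ) :
    chooseSeries z a = c ^ a / (1 - 2 * (z * c)) := by
  -- `D` is the defect from being geometric of ratio `c`. Since `c` is a characteristic root, the
  -- recurrence drops to first order on `D`.
  set D : ℕ → ℂ := fun n => chooseSeries z (n + 1) - c * chooseSeries z n with hD
  have hstep : ∀ n, D n = z * c * D (n + 1) := by
    intro n
    simp only [hD]
    linear_combination c * chooseSeries_succ hz n - chooseSeries z (n + 1) * hc
  have hiter : ∀ m n, D n = (z * c) ^ m * D (n + m) := by
    intro m
    induction m with
    | zero => intro n; simp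
    | succ m ih =>
      intro n
      rw [ih n, hstep (n + m), pow_succ, add_assoc]
      ring
  have hbound : ∀ n, ‖D n‖ ≤ 2 ^ n * ((2 + ‖c‖) * (1 - 4 * ‖z‖)⁻¹) := by
    intro n
    calc ‖D n‖ ≤ ‖chooseSeries z (n + 1)‖ + ‖c‖ * ‖chooseSeries z n‖ := by
          rw [← norm_mul]; exact norm_sub_le _ _
      _ ≤ 2 ^ (n + 1) * (1 - 4 * ‖z‖)⁻¹ + ‖c‖ * (2 ^ n * (1 - 4 * ‖z‖)⁻¹) := by
          gcongr <;> exact norm_chooseSeries_le hz _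
      _ = _ := by ring
  have hzero : ∀ n, D n = 0 := by
    intro n
    rw [← norm_eq_zero]
    -- Iterating `m` times gains `(zc)^m` and costs at most `2^m`, so `‖2zc‖ < 1` forces `D = 0`.
    refine le_antisymm (ge_of_tendsto' (f := fun m : ℕ =>
      ‖2 * (z * c)‖ ^ m * (2 ^ n * ((2 + ‖c‖) * (1 - 4 * ‖z‖)⁻¹))) (x := Filter.atTop) ?_ ?_)
      (norm_nonneg _)
    · simpa using (tendsto_pow_atTop_nhds_zero_of_lt_one (norm_nonneg _) hzc).mul_const
        (2 ^ n * ((2 + ‖c‖) * (1 - 4 * ‖z‖)⁻¹))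
    · intro m
      rw [hiter m n, norm_mul, norm_pow]
      calc ‖z * c‖ ^ m * ‖D (n + m)‖
          ≤ ‖z * c‖ ^ m * (2 ^ (n + m) * ((2 + ‖c‖) * (1 - 4 * ‖z‖)⁻¹)) := by
            gcongr; exact hbound _
        _ = _ := by rw [norm_mul 2, Complex.norm_ofNat, mul_pow]; ring
  have hne : 1 - 2 * (z * c) ≠ 0 := by
    intro h
    rw [← sub_eq_zero.1 h] at hzc
    simp at hzc
  induction a with
  | zero =>
    have h1 := hzero 0
    simp only [hD, zero_add] at h1
    rw [pow_zero, eq_div_iff hne]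
    linear_combination chooseSeries_zero hz + 2 * z * h1
  | succ a ih =>
    have h1 := hzero a
    simp only [hD] at h1
    rw [sub_eq_zero.1 h1, ih]
    ring

/-! ### Convergence and summation of the triple series -/

/-- Binomials are bounded by powers of two and `a!` below by 1. For `‖x‖, ‖y‖ < 1/8` all three
ratios are below 1. -/
lemma norm_tripleTerm_le {x y : ℂ} (a k b : ℕ) :
    ‖tripleTerm x y a k b‖ ≤
      (4 * ‖y‖) ^ a * ((8 * ‖x‖ * ‖y‖) ^ k * (2 * ‖x‖) ^ b) := by
  have h1 : ((b + (a + 2 * k)).choose (a + 2 * k) : ℝ) ≤ 2 ^ (b + (a + 2 * k)) := by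
    exact_mod_cast Nat.choose_le_two_pow _ _
  have h2 : ((a + 2 * k).choose k : ℝ) ≤ 2 ^ (a + 2 * k) := by
    exact_mod_cast Nat.choose_le_two_pow _ _
  have h3 : (1 : ℝ) ≤ a.factorial := by exact_mod_cast a.factorial_pos
  rw [tripleTerm, norm_div, norm_mul, norm_mul, norm_mul, norm_mul, norm_pow, norm_pow, norm_pow,
    Complex.norm_natCast, Complex.norm_natCast, Complex.norm_natCast, Complex.norm_ofNat]
  calc _ ≤ (2 ^ (b + (a + 2 * k)) * 2 ^ (a + 2 * k)) * (‖x‖ ^ (b + k) * ‖y‖ ^ (a + k)) /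
        (2 ^ k * 1) := by gcongr
    _ = _ := by
      rw [div_eq_iff (by positivity)]
      have h4 : (4 : ℝ) ^ a = 2 ^ (2 * a) := by rw [pow_mul]; norm_num
      have h8 : (8 : ℝ) ^ k = 2 ^ (3 * k) := by rw [pow_mul]; norm_num
      simp only [mul_pow, h4, h8]
      ring

lemma summable_tripleTerm {x y : ℂ} (hx : ‖x‖ < 1 / 8) (hy : ‖y‖ < 1 / 8) :
    Summable fun t : ℕ × ℕ × ℕ => tripleTerm x y t.1 t.2.1 t.2.2 := by
  have hxy : 8 * ‖x‖ * ‖y‖ < 1 := by nlinarith [norm_nonneg x, norm_nonneg y]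
  have h1 := summable_geometric_of_lt_one (r := 4 * ‖y‖) (by positivity) (by linarith)
  have h2 := summable_geometric_of_lt_one (by positivity) hxy
  have h3 := summable_geometric_of_lt_one (r := 2 * ‖x‖) (by positivity) (by linarith)
  have h := h1.mul_of_nonneg (h2.mul_of_nonneg h3 (fun _ => by positivity)
    (fun _ => by positivity)) (fun _ => by positivity) (fun _ => by positivity)
  exact .of_norm_bounded h fun t => norm_tripleTerm_le _ _ _

lemma hasSum_tripleTerm_fst {x y z : ℂ} (hx : ‖x‖ < 1) (hz : z = x * y / (2 * (1 - x) ^ 2))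
    (a k : ℕ) : HasSum (fun b => tripleTerm x y a k b)
      ((y / (1 - x)) ^ a / (a.factorial : ℂ) / (1 - x) * (((a + 2 * k).choose k : ℂ) * z ^ k)) := by
  have hne : 1 - x ≠ 0 := by
    intro h
    rw [← sub_eq_zero.1 h] at hx
    simp at hx
  have h := (hasSum_choose_mul_geometric_of_norm_lt_one (a + 2 * k) hx).mul_left
    (((a + 2 * k).choose k : ℂ) * (x ^ k * y ^ (a + k)) / (2 ^ k * (a.factorial : ℂ)))
  have hf : (a.factorial : ℂ) ≠ 0 := by exact_mod_cast a.factorial_ne_zero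
  have hsum : (y / (1 - x)) ^ a / (a.factorial : ℂ) / (1 - x) *
      (((a + 2 * k).choose k : ℂ) * z ^ k) =
      ((a + 2 * k).choose k : ℂ) * (x ^ k * y ^ (a + k)) / (2 ^ k * (a.factorial : ℂ)) *
        (1 / (1 - x) ^ (a + 2 * k + 1)) := by
    rw [hz]
    generalize 1 - x = w at hne
    simp only [div_pow, mul_pow]
    field_simp
    ring
  rw [hsum]
  convert! h using 2 with b
  rw [tripleTerm]
  ring

lemma tsum_tripleTerm {x y c : ℂ} (hx : ‖x‖ < 1 / 8) (hy : ‖y‖ < 1 / 8)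
    (hc : c = 1 + x * y / (2 * (1 - x) ^ 2) * c ^ 2)
    (hzc : ‖2 * (x * y / (2 * (1 - x) ^ 2) * c)‖ < 1) :
    HasSum (fun t : ℕ × ℕ × ℕ => tripleTerm x y t.1 t.2.1 t.2.2)
      (Complex.exp (y / (1 - x) * c) / ((1 - x) * (1 - 2 * (x * y / (2 * (1 - x) ^ 2) * c)))) := by
  set z := x * y / (2 * (1 - x) ^ 2) with hzdef
  have h1x : 1 / 2 ≤ ‖1 - x‖ := by
    have := norm_sub_norm_le (1 : ℂ) x
    rw [norm_one] at this
    linarith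
  have hz : 4 * ‖z‖ < 1 := by
    rw [hzdef, norm_div, norm_mul, norm_mul, norm_pow, Complex.norm_ofNat, ← mul_div_assoc,
      div_lt_one (by positivity)]
    nlinarith [norm_nonneg x, norm_nonneg y]
  have hs := summable_tripleTerm hx hy
  have hin : ∀ a, HasSum (fun t : ℕ × ℕ => tripleTerm x y a t.1 t.2)
      ((y / (1 - x)) ^ a / (a.factorial : ℂ) / (1 - x) * chooseSeries z a) := by
    intro a
    have hsa : Summable fun t : ℕ × ℕ => tripleTerm x y a t.1 t.2 := hs.prod_factor a
    have h1 := hsa.hasSum.prod_fiberwise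
      (fun k => hasSum_tripleTerm_fst (hx.trans (by norm_num)) hzdef a k)
    have h2 := (summable_chooseSeries hz a).hasSum.mul_left
      ((y / (1 - x)) ^ a / (a.factorial : ℂ) / (1 - x))
    rw [chooseSeries, h2.unique h1]
    exact hsa.hasSum
  have h1 := hs.hasSum.prod_fiberwise hin
  have h2 := (NormedSpace.expSeries_div_hasSum_exp (y / (1 - x) * c)).mul_right
    ((1 - x) * (1 - 2 * (z * c)))⁻¹
  rw [← Complex.exp_eq_exp_ℂ, ← div_eq_mul_inv] at h2
  have hterm : ∀ a : ℕ, (y / (1 - x)) ^ a / (a.factorial : ℂ) / (1 - x) * chooseSeries z a =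
      (y / (1 - x) * c) ^ a / (a.factorial : ℂ) * ((1 - x) * (1 - 2 * (z * c)))⁻¹ := by
    intro a
    rw [chooseSeries_eq hz hc hzc, mul_pow, mul_inv]
    ring
  simp only [hterm] at h1
  rw [h2.unique h1]
  exact hs.hasSum

/-- Summing the generating series over `(a, k, b)` amounts to summing it over `(a + k, b + k)`. -/
lemma hasSum_seriesTerm_of_tripleTerm {x y w : ℂ}
    (h : HasSum (fun t : ℕ × ℕ × ℕ => tripleTerm x y t.1 t.2.1 t.2.2) w) :
    HasSum (seriesTerm x y) w := by
  set i : ℕ × ℕ × ℕ → (ℕ × ℕ) × ℕ := fun t => ((t.1 + t.2.1, t.2.2 + t.2.1), t.2.1) with hi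
  have hinj : Function.Injective i := by
    rintro ⟨a, k, b⟩ ⟨a', k', b'⟩ h
    simp only [hi, Prod.mk.injEq] at h ⊢
    omega
  -- The range of `i` is exactly `k ≤ min p q`; extension by zero turns the finite fibre sums into
  -- sums over all `k`.
  set f : (ℕ × ℕ) × ℕ → ℂ := fun m =>
    if m.2 ≤ min m.1.1 m.1.2 then tripleTerm x y (m.1.1 - m.2) m.2 (m.1.2 - m.2) else 0 with hf
  have hfi : f ∘ i = fun t : ℕ × ℕ × ℕ => tripleTerm x y t.1 t.2.1 t.2.2 := by
    funext ⟨a, k, b⟩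
    simp [hf, hi]
  have hout : ∀ m ∉ Set.range i, f m = 0 := by
    rintro ⟨⟨p, q⟩, k⟩ hm
    refine if_neg fun hk => hm ⟨(p - k, k, q - k), ?_⟩
    have hp : p - k + k = p := Nat.sub_add_cancel (hk.trans (min_le_left p q))
    have hq : q - k + k = q := Nat.sub_add_cancel (hk.trans (min_le_right p q))
    simp only [hi, hp, hq]
  rw [← hfi, hinj.hasSum_iff hout] at h
  refine h.prod_fiberwise fun ⟨p, q⟩ => ?_
  rw [seriesTerm_eq_sum]
  have hsum : ∑ k ∈ Finset.range (min p q + 1), tripleTerm x y (p - k) k (q - k) =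
      ∑ k ∈ Finset.range (min p q + 1), f ((p, q), k) :=
    Finset.sum_congr rfl fun k hk => (if_pos (Nat.lt_succ_iff.1 (Finset.mem_range.1 hk))).symm
  rw [hsum]
  exact hasSum_sum_of_ne_finset_zero fun k hk =>
    if_neg fun h' => hk (Finset.mem_range.2 (Nat.lt_succ_of_le h'))

lemma summable_seriesTerm {x y : ℂ} (hx : ‖x‖ < 1 / 8) (hy : ‖y‖ < 1 / 8) :
    Summable (seriesTerm x y) :=
  (hasSum_seriesTerm_of_tripleTerm (summable_tripleTerm hx hy).hasSum).summable

/-! ### Evaluation in the coordinates `r, s` -/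

lemma v_xCoord_yCoord {r s : ℂ} (h1 : r * s + 1 ≠ 0) (h2 : 1 - r ≠ 0) (h3 : r * s + 1 - r ≠ 0)
    (h4 : r * s - 2 * r + 2 ≠ 0) (hx : ‖xCoord r s‖ < 1 / 8) (hy : ‖yCoord r s‖ < 1 / 8)
    (h5 : ‖r * s / (r * s + 1 - r)‖ < 1) :
    v (xCoord r s) (yCoord r s) = Complex.exp s * (r * s + 1) / (1 - r) := by
  have hx1 : 1 - xCoord r s = (r * s + 1 - r) / (r * s + 1) := by
    rw [xCoord]
    field_simp
  have h4' : r * (s - 2) + 2 ≠ 0 := by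
    convert h4 using 1
    ring
  -- The root of `c = 1 + z c^2` tending to 1 at the origin; here `1 - 4z` is the square of
  -- `(1-r)/(rs+1-r)`.
  set c := 2 * (r * s + 1 - r) / (r * s - 2 * r + 2) with hc
  have hz : xCoord r s * yCoord r s / (2 * (1 - xCoord r s) ^ 2) =
      r * s * (r * s - 2 * r + 2) / (4 * (r * s + 1 - r) ^ 2) := by
    rw [hx1, xCoord, yCoord]
    field_simp
    ring
  have hu : yCoord r s / (1 - xCoord r s) * c = s := by
    rw [hx1, yCoord, hc]
    field_simp
  have hzc : 2 * (xCoord r s * yCoord r s / (2 * (1 - xCoord r s) ^ 2) * c) =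
      r * s / (r * s + 1 - r) := by
    rw [hz, hc]
    field_simp
    ring
  have h := hasSum_seriesTerm_of_tripleTerm (tsum_tripleTerm (c := c) hx hy
    (by rw [hz, hc]; field_simp; ring) (by rw [hzc]; exact h5))
  rw [v, h.tsum_eq, hu, hzc, hx1]
  have h6 : 1 - r * s / (r * s + 1 - r) = (1 - r) / (r * s + 1 - r) := by
    field_simp
    ring
  rw [h6]
  field_simp

/-! ### Local inversion at the origin -/

/-- The change of coordinates `(r, s) ↦ (x, y)`. -/
noncomputable def coordMap (w : ℂ × ℂ) : ℂ × ℂ := (xCoord w.1 w.2, yCoord w.1 w.2)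

lemma analyticAt_coordMap_zero : AnalyticAt ℂ coordMap (0, 0) := by
  have hr : AnalyticAt ℂ (fun w : ℂ × ℂ => w.1) (0, 0) := analyticAt_fst
  have hs : AnalyticAt ℂ (fun w : ℂ × ℂ => w.2) (0, 0) := analyticAt_snd
  have hc : ∀ a : ℂ, AnalyticAt ℂ (fun _ : ℂ × ℂ => a) (0, 0) := fun _ => analyticAt_const
  have hd := (hr.mul hs).add (hc 1)
  exact (hr.div hd (by simp)).prod
    ((((hr.mul (hs.pow 2)).sub (((hc 2).mul hr).mul hs)).add ((hc 2).mul hs)).div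
      ((hc 2).mul hd) (by simp))

/-- The map is the identity on both coordinate axes, which determines its derivative. -/
lemma fderiv_coordMap_zero :
    fderiv ℂ coordMap (0, 0) = (ContinuousLinearEquiv.refl ℂ (ℂ × ℂ) : (ℂ × ℂ) →L[ℂ] ℂ × ℂ) := by
  have hd := analyticAt_coordMap_zero.differentiableAt
  have h1 : HasDerivAt (fun t : ℂ => coordMap (t, 0)) (1, 0) 0 := by
    have : (fun t : ℂ => coordMap (t, 0)) = fun t => (t, 0) := by
      funext t
      simp [coordMap, xCoord, yCoord]
    rw [this]
    exact (hasDerivAt_id _).prodMk (hasDerivAt_const _ _)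
  have h2 : HasDerivAt (fun t : ℂ => coordMap (0, t)) (0, 1) 0 := by
    have : (fun t : ℂ => coordMap (0, t)) = fun t => (0, t) := by
      funext t
      simp [coordMap, xCoord, yCoord]
    rw [this]
    exact (hasDerivAt_const _ _).prodMk (hasDerivAt_id _)
  have h1' := HasFDerivAt.comp_hasDerivAt (f := fun t : ℂ => (t, (0 : ℂ))) (0 : ℂ) hd.hasFDerivAt
    ((hasDerivAt_id (0 : ℂ)).prodMk (hasDerivAt_const (0 : ℂ) (0 : ℂ)))
  have h2' := HasFDerivAt.comp_hasDerivAt (f := fun t : ℂ => ((0 : ℂ), t)) (0 : ℂ) hd.hasFDerivAt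
    ((hasDerivAt_const (0 : ℂ) (0 : ℂ)).prodMk (hasDerivAt_id (0 : ℂ)))
  have e1 := h1'.unique h1
  have e2 := h2'.unique h2
  refine ContinuousLinearMap.ext fun w => ?_
  have hw : w = w.1 • ((1 : ℂ), (0 : ℂ)) + w.2 • ((0 : ℂ), (1 : ℂ)) := by
    ext <;> simp
  conv_lhs => rw [hw, map_add, map_smul, map_smul, e1, e2, ← hw]
  rfl

/-- `e.source` and `e.target` serve as `U` and `V`. In `ℂ`, `Summable` is absolute convergence. -/
theorem theorem1p4 :
    ∃ e : OpenPartialHomeomorph (ℂ × ℂ) (ℂ × ℂ),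
      (0, 0) ∈ e.source ∧ e (0, 0) = (0, 0) ∧
      AnalyticOnNhd ℂ e.symm e.target ∧
      (∀ x y : ℂ, (x, y) ∈ e.target → Summable (seriesTerm x y)) ∧
      (∀ r s : ℂ, (r, s) ∈ e.source →
        r * s + 1 ≠ 0 ∧ 1 - r ≠ 0 ∧
        e (r, s) = (xCoord r s, yCoord r s) ∧
        v (xCoord r s) (yCoord r s) = Complex.exp s * (r * s + 1) / (1 - r)) := by
  have hstrict : HasStrictFDerivAt coordMap
      (ContinuousLinearEquiv.refl ℂ (ℂ × ℂ) : (ℂ × ℂ) →L[ℂ] ℂ × ℂ) (0, 0) := by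
    rw [← fderiv_coordMap_zero]
    exact analyticAt_coordMap_zero.hasStrictFDerivAt
  set e₀ := hstrict.toOpenPartialHomeomorph coordMap with he₀
  have hcoe : (e₀ : ℂ × ℂ → ℂ × ℂ) = coordMap := hstrict.toOpenPartialHomeomorph_coe
  have h0 : ((0 : ℂ), (0 : ℂ)) ∈ e₀.source := hstrict.mem_toOpenPartialHomeomorph_source
  have hc0 : coordMap (0, 0) = (0, 0) := by simp [coordMap, xCoord, yCoord]
  have hsymm0 : e₀.symm (0, 0) = (0, 0) := by
    have := e₀.left_inv h0
    rwa [hcoe, hc0] at this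
  have htarget : ((0 : ℂ), (0 : ℂ)) ∈ e₀.target := by
    have := e₀.map_source h0
    rwa [hcoe, hc0] at this
  have hanalytic : ∀ᶠ w in nhds ((0 : ℂ), (0 : ℂ)), AnalyticAt ℂ e₀.symm w := by
    refine (e₀.analyticAt_symm (i := .refl ℂ (ℂ × ℂ)) htarget ?_ ?_).eventually_analyticAt
    · rw [hsymm0, hcoe]
      exact analyticAt_coordMap_zero
    · rw [hsymm0, hcoe]
      exact fderiv_coordMap_zero
  have hcont := analyticAt_coordMap_zero.continuousAt
  have hcont' : Filter.Tendsto coordMap (nhds (0, 0)) (nhds (0, 0)) := by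
    have := hcont.tendsto
    rwa [hc0] at this
  have hsmall : ∀ᶠ w in nhds ((0 : ℂ), (0 : ℂ)), ‖w.1‖ < 1 / 8 ∧ ‖w.2‖ < 1 / 8 :=
    (ContinuousAt.eventually_lt (f := fun w : ℂ × ℂ => ‖w.1‖) (by fun_prop) continuousAt_const
      (by simp)).and (ContinuousAt.eventually_lt (f := fun w : ℂ × ℂ => ‖w.2‖) (by fun_prop)
      continuousAt_const (by simp))
  have hregular : ∀ᶠ w in nhds ((0 : ℂ), (0 : ℂ)), w.1 * w.2 + 1 ≠ 0 ∧ 1 - w.1 ≠ 0 ∧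
      w.1 * w.2 + 1 - w.1 ≠ 0 ∧ w.1 * w.2 - 2 * w.1 + 2 ≠ 0 ∧
      ‖w.1 * w.2 / (w.1 * w.2 + 1 - w.1)‖ < 1 := by
    refine (ContinuousAt.eventually_ne (by fun_prop) (by simp)).and
      ((ContinuousAt.eventually_ne (by fun_prop) (by simp)).and
      ((ContinuousAt.eventually_ne (by fun_prop) (by simp)).and
      ((ContinuousAt.eventually_ne (by fun_prop) (by simp)).and
      (ContinuousAt.eventually_lt (ContinuousAt.norm (ContinuousAt.div (by fun_prop) (by fun_prop)
        (by simp))) continuousAt_const (by simp)))))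
  -- Smallness and analyticity are imposed at `coordMap w`, so they hold throughout the target after
  -- restriction to `U`.
  obtain ⟨U, hU, hUo, h0U⟩ := eventually_nhds_iff.1
    (hregular.and (hcont'.eventually (hsmall.and hanalytic)))
  refine ⟨e₀.restrOpen U hUo, ⟨h0, h0U⟩, ?_, ?_, ?_, ?_⟩
  · change e₀ (0, 0) = (0, 0)
    rw [hcoe, hc0]
  · intro w hw
    have hs := (e₀.restrOpen U hUo).map_target hw
    have hr := (e₀.restrOpen U hUo).right_inv hw
    have := (hU _ hs.2).2.2
    rw [← hcoe] at this
    change AnalyticAt ℂ e₀.symm (e₀ (e₀.symm w)) at this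
    change e₀ (e₀.symm w) = w at hr
    rwa [hr] at this
  · intro x y hw
    have hs := (e₀.restrOpen U hUo).map_target hw
    have hr := (e₀.restrOpen U hUo).right_inv hw
    have := (hU _ hs.2).2.1
    rw [← hcoe] at this
    change ‖(e₀ (e₀.symm (x, y))).1‖ < 1 / 8 ∧ ‖(e₀ (e₀.symm (x, y))).2‖ < 1 / 8 at this
    change e₀ (e₀.symm (x, y)) = (x, y) at hr
    rw [hr] at this
    exact summable_seriesTerm this.1 this.2
  · intro r s hrs
    obtain ⟨⟨h1, h2, h3, h4, h5⟩, ⟨hx, hy⟩, -⟩ := hU _ hrs.2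
    refine ⟨h1, h2, ?_, v_xCoord_yCoord h1 h2 h3 h4 hx hy h5⟩
    change e₀ (r, s) = _
    rw [hcoe]
    rfl
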